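/- Let $L$ be a nonzero complex number. For $g_2,g_3\in\mathbb C$ with $g_2^3-27g_3^2\neq 0$, let $\wp(z)=\wp(z;g_2,g_3)$ denote the Weierstrass elliptic function with invariants $g_2,g_3$, so that $\wp'^2=4\wp^3-g_2\wp-g_3$. For an equation $(u')^k=R(u)$ with $R$ a polynomial, say that a family $(\varphi_{z_0})_{z_0\in\mathbb C}$ of meromorphic functions on $\mathbb C$ is its general solution if, on every nonempty connected open set $U\subseteq\mathbb C$, the nonconstant meromorphic solutions are exactly the restrictions to $U$ of the functions $\varphi_{z_0}$, $z_0\in\mathbb C$. Then: (i) There is a period lattice with invariants $g_2=0$, $g_3=-\frac{4L^6}{729}$, and for the corresponding $\wp$ the general solution of $$\left(\frac{du}{dz}\right)^3=L^3u^2(u-1)^2(u+1)^2$$ is $$u(z)=-\frac{2L^3}{27\,\wp'(z-z_0)},\qquad z_0\in\mathbb C \text{ arbitrary}.$$ (ii) There is a period lattice with invariants $g_2=-\frac{L^4}{16}$, $g_3=0$, and for the corresponding $\wp$ the general solution of $$\left(\frac{du}{dz}\right)^4=L^4u^2(u-1)^3(u+1)^3$$ is $$u(z)=1+\frac{L^4}{32\left(\wp^2(z-z_0)-\frac{L^4}{64}\right)},\qquad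 z_0\in\mathbb C \text{ arbitrary}.$$ -/

import Mathlib

open Filter

/-- `u` is a meromorphic solution on `U` of the autonomous binomial equation `(u')^k = R(u)`:
`u` is meromorphic on `U` and satisfies the equation at every point of `U` where it is analytic
(that is, away from its poles and from the isolated points where it carries no proper value). -/
def IsMeromorphicSolutionOn (k : ℕ) (R : ℂ → ℂ) (U : Set ℂ) (u : ℂ → ℂ) : Prop :=
  MeromorphicOn u U ∧ ∀ z ∈ U, AnalyticAt ℂ u z → deriv u z ^ k = R (u z)

/-- `u` and `v` define the same meromorphic function on `U`: they agree on `U` outside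
a set without accumulation point in `U`. -/
def SameMeromorphicOn (U : Set ℂ) (u v : ℂ → ℂ) : Prop :=
  u =ᶠ[codiscreteWithin U] v

/-- The one-parameter family `φ z₀`, with `z₀ : ℂ` arbitrary, is the general solution of
`(u')^k = R(u)`: on every domain `U` of the complex plane, the nonconstant meromorphic solutions
are exactly the (restrictions to `U` of the) members of the family. -/
def IsGeneralSolution (k : ℕ) (R : ℂ → ℂ) (φ : ℂ → ℂ → ℂ) : Prop :=
  ∀ U : Set ℂ, IsOpen U → IsConnected U → ∀ u : ℂ → ℂ,
    (IsMeromorphicSolutionOn k R U u ∧ ¬ ∃ c : ℂ, SameMeromorphicOn U u (fun _ => c)) ↔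
      ∃ z₀ : ℂ, SameMeromorphicOn U u (φ z₀)

/-!
Near a point where `u'` does not vanish, a solution of `(u')^k = R(u)` has a local inverse `ψ` with
`ψ'^k R = 1`. Two such inverses with the same derivative at a point have the same derivative nearby,
hence differ by a constant, and the two solutions are translates of each other. So a single
meromorphic solution on `ℂ` whose pairs `(φ p, φ' p)` exhaust the points of the curve `c ^ k = R b`
with `R b ≠ 0` yields the general solution by translation.

In both equations this curve is birational to the Weierstrass cubic, every affine point of which is
`(℘ p, ℘' p)` for some `p`. The lattices come from the triangular and the square lattice, whose
symmetries of order 3 and 4 force `g₂ = 0` and `g₃ = 0` respectively; the other invariant is then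
nonzero by the discriminant and takes any nonzero value after rescaling.
-/

open scoped Topology

section LocalUniqueness

theorem eventuallyEq_of_pow_eventuallyEq {X K : Type*} [TopologicalSpace X] [CommRing K]
    [NoZeroDivisors K] [CharZero K] [TopologicalSpace K] [IsTopologicalRing K] [T1Space K]
    {k : ℕ} (hk : k ≠ 0) {f g : X → K} {x : X} (hf : ContinuousAt f x) (hg : ContinuousAt g x)
    (hx : f x = g x) (hne : g x ≠ 0) (h : f ^ k =ᶠ[𝓝 x] g ^ k) : f =ᶠ[𝓝 x] g := by
  let s : X → K := fun y => ∑ i ∈ Finset.range k, f y ^ i * g y ^ (k - 1 - i)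
  have hs : ContinuousAt s x := by fun_prop
  have hsx : s x ≠ 0 := by
    simp only [s, hx, geom_sum₂_self]
    exact mul_ne_zero (Nat.cast_ne_zero.2 hk) (pow_ne_zero _ hne)
  filter_upwards [h, hs.eventually_ne hsx] with y hy hsy
  have hfactor : s y * (f y - g y) = 0 := by
    rw [geom_sum₂_mul, sub_eq_zero]
    exact hy
  exact sub_eq_zero.1 ((mul_eq_zero.1 hfactor).resolve_left hsy)

variable {𝕜 : Type*} [NontriviallyNormedField 𝕜] [CharZero 𝕜]

theorem eventuallyEq_const_of_deriv_eventuallyEq_zero {E : Type*} [NormedAddCommGroup E]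
    [NormedSpace 𝕜 E] [CompleteSpace E] {f : 𝕜 → E} {z : 𝕜} (hf : AnalyticAt 𝕜 f z)
    (h : deriv f =ᶠ[𝓝 z] 0) : f =ᶠ[𝓝 z] fun _ => f z := by
  have horder : analyticOrderAt (fun y => f y - f z) z = ⊤ := by
    rw [← hf.analyticOrderAt_deriv_add_one, analyticOrderAt_eq_top.2 h, top_add]
  exact (analyticOrderAt_eq_top.1 horder).mono fun y hy => sub_eq_zero.1 hy

variable [CompleteSpace 𝕜] {k : ℕ}

theorem sub_eventuallyEq_const_of_deriv_pow_eventuallyEq (hk : k ≠ 0) {f g : 𝕜 → 𝕜} {z : 𝕜}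
    (hf : AnalyticAt 𝕜 f z) (hg : AnalyticAt 𝕜 g z) (hz : deriv f z = deriv g z)
    (hne : deriv g z ≠ 0) (h : deriv f ^ k =ᶠ[𝓝 z] deriv g ^ k) :
    f - g =ᶠ[𝓝 z] fun _ => f z - g z := by
  have hderiv : deriv f =ᶠ[𝓝 z] deriv g :=
    eventuallyEq_of_pow_eventuallyEq hk hf.deriv.continuousAt hg.deriv.continuousAt hz hne h
  refine eventuallyEq_const_of_deriv_eventuallyEq_zero (hf.sub hg) ?_
  filter_upwards [hderiv, hf.eventually_analyticAt, hg.eventually_analyticAt] with y hy hfy hgy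
  rw [deriv_sub hfy.differentiableAt hgy.differentiableAt, hy, sub_self, Pi.zero_apply]

variable {R u φ : 𝕜 → 𝕜} {z p : 𝕜}

theorem eventually_deriv_localInverse_pow_mul_eq_one (hu : AnalyticAt 𝕜 u z)
    (hne : deriv u z ≠ 0) (hode : ∀ᶠ y in 𝓝 z, deriv u y ^ k = R (u y)) :
    ∀ᶠ w in 𝓝 (u z),
      deriv (hu.hasStrictDerivAt.localInverse u (deriv u z) z hne) w ^ k * R w = 1 := by
  set ψ := hu.hasStrictDerivAt.localInverse u (deriv u z) z hne
  have hψ : AnalyticAt 𝕜 ψ (u z) := hu.analyticAt_localInverse hne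
  have hψz : ψ (u z) = z := (hu.hasStrictDerivAt.eventually_left_inverse hne).self_of_nhds
  have htendsto : Tendsto ψ (𝓝 (u z)) (𝓝 z) := by simpa only [hψz] using hψ.continuousAt.tendsto
  have hinv : ∀ᶠ w in 𝓝 (u z), u (ψ w) = w :=
    hu.hasStrictDerivAt.eventually_right_inverse hne
  filter_upwards [hinv.eventually_nhds, hψ.eventually_analyticAt,
    htendsto.eventually (hu.eventually_analyticAt.and hode)] with w hw hψw ⟨huw, hodew⟩
  have hchain : deriv u (ψ w) * deriv ψ w = 1 := by
    have hcomp : u ∘ ψ =ᶠ[𝓝 w] id := hw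
    rw [← deriv_comp w huw.differentiableAt hψw.differentiableAt, hcomp.deriv_eq, deriv_id]
  rw [hw.self_of_nhds] at hodew
  rw [← hodew, mul_comm, ← mul_pow, hchain, one_pow]

theorem eventuallyEq_comp_sub_of_deriv_pow_eq (hk : k ≠ 0) (hu : AnalyticAt 𝕜 u z)
    (hφ : AnalyticAt 𝕜 φ p) (hval : φ p = u z) (hder : deriv φ p = deriv u z)
    (hne : deriv u z ≠ 0) (huode : ∀ᶠ y in 𝓝 z, deriv u y ^ k = R (u y))
    (hφode : ∀ᶠ y in 𝓝 p, deriv φ y ^ k = R (φ y)) :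
    u =ᶠ[𝓝 z] fun y => φ (y - (z - p)) := by
  have hφne : deriv φ p ≠ 0 := hder ▸ hne
  set ψu := hu.hasStrictDerivAt.localInverse u (deriv u z) z hne
  set ψφ := hφ.hasStrictDerivAt.localInverse φ (deriv φ p) p hφne
  have hanu : AnalyticAt 𝕜 ψu (u z) := hu.analyticAt_localInverse hne
  have hanφ : AnalyticAt 𝕜 ψφ (u z) := hval ▸ hφ.analyticAt_localInverse hφne
  have hleft : ∀ᶠ y in 𝓝 z, ψu (u y) = y := hu.hasStrictDerivAt.eventually_left_inverse hne
  have hright : ∀ᶠ w in 𝓝 (u z), φ (ψφ w) = w :=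
    hval ▸ hφ.hasStrictDerivAt.eventually_right_inverse hφne
  have hψp : ψφ (u z) = p := by
    rw [← hval]
    exact (hφ.hasStrictDerivAt.eventually_left_inverse hφne).self_of_nhds
  have hderu : deriv ψu (u z) = (deriv u z)⁻¹ :=
    (hu.hasStrictDerivAt.to_localInverse hne).hasDerivAt.deriv
  have hderφ : deriv ψφ (u z) = (deriv u z)⁻¹ := by
    rw [← hval, ← hder]
    exact (hφ.hasStrictDerivAt.to_localInverse hφne).hasDerivAt.deriv
  have hpow : deriv ψu ^ k =ᶠ[𝓝 (u z)] deriv ψφ ^ k := by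
    filter_upwards [eventually_deriv_localInverse_pow_mul_eq_one hu hne huode,
      hval ▸ eventually_deriv_localInverse_pow_mul_eq_one hφ hφne hφode] with w hwu hwφ
    exact mul_right_cancel₀ (right_ne_zero_of_mul_eq_one hwu) (hwu.trans hwφ.symm)
  have hconst : ψu - ψφ =ᶠ[𝓝 (u z)] fun _ => z - p := by
    simpa only [hleft.self_of_nhds, hψp] using
      sub_eventuallyEq_const_of_deriv_pow_eventuallyEq hk hanu hanφ (hderu.trans hderφ.symm)
        (by rw [hderφ]; exact inv_ne_zero hne) hpow
  filter_upwards [hleft, hu.continuousAt.eventually (hright.and hconst)] with y hy ⟨hφy, hyconst⟩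
  rw [← hyconst, Pi.sub_apply, hy, sub_sub_cancel, hφy]

end LocalUniqueness

section GeneralSolution

theorem sameMeromorphicOn_of_eventuallyEq_nhdsNE {U : Set ℂ} {u v : ℂ → ℂ}
    (hU : IsPreconnected U) (hu : MeromorphicOn u U) (hv : MeromorphicOn v U) {z : ℂ} (hz : z ∈ U)
    (h : u =ᶠ[𝓝[≠] z] v) : SameMeromorphicOn U u v := by
  have hz_top : meromorphicOrderAt (u - v) z = ⊤ :=
    meromorphicOrderAt_eq_top_iff.2 (h.mono fun y hy => sub_eq_zero.2 hy)
  refine mem_codiscreteWithin_iff_forall_mem_nhdsNE.2 fun x hx => ?_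
  have hx_top : meromorphicOrderAt (u - v) x = ⊤ := by
    by_contra hne
    exact (hu.sub hv).meromorphicOrderAt_ne_top_of_isPreconnected hU hx hz hne hz_top
  filter_upwards [meromorphicOrderAt_eq_top_iff.1 hx_top] with y hy
  exact Or.inl (sub_eq_zero.1 hy)

theorem SameMeromorphicOn.eventuallyEq_nhdsNE {U : Set ℂ} {u v : ℂ → ℂ}
    (h : SameMeromorphicOn U u v) (hU : IsOpen U) {z : ℂ} (hz : z ∈ U) : u =ᶠ[𝓝[≠] z] v := by
  filter_upwards [mem_codiscreteWithin_iff_forall_mem_nhdsNE.1 h z hz,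
    nhdsWithin_le_nhds (hU.mem_nhds hz)] with y hy hyU
  exact hy.resolve_right fun hyU' => hyU' hyU

theorem not_sameMeromorphicOn_const {U : Set ℂ} (hUo : IsOpen U) (hUne : U.Nonempty) {f : ℂ → ℂ}
    (hf : Meromorphic f) {p : ℂ} (hp : AnalyticAt ℂ f p) (hderiv : deriv f p ≠ 0) (c : ℂ) :
    ¬ SameMeromorphicOn U f fun _ => c := by
  intro hconst
  obtain ⟨x, hx⟩ := hUne
  have hconst_univ : SameMeromorphicOn Set.univ f fun _ => c :=
    sameMeromorphicOn_of_eventuallyEq_nhdsNE isPreconnected_univ (fun y _ => hf y)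
      (fun y _ => MeromorphicAt.const c y) (Set.mem_univ x) (hconst.eventuallyEq_nhdsNE hUo hx)
  have hconst_p : f =ᶠ[𝓝 p] fun _ => c :=
    (hp.continuousAt.eventuallyEq_nhds_iff_eventuallyEq_nhdsNE continuousAt_const).1
      (hconst_univ.eventuallyEq_nhdsNE isOpen_univ (Set.mem_univ p))
  exact hderiv (by rw [hconst_p.deriv_eq, deriv_const])

variable {k : ℕ} {R : ℂ → ℂ} {U : Set ℂ} {u v φ : ℂ → ℂ}

theorem isMeromorphicSolutionOn_iff_eventually_nhdsNE (hR : Continuous R) (hU : IsOpen U) :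
    IsMeromorphicSolutionOn k R U u ↔
      MeromorphicOn u U ∧ ∀ z ∈ U, ∀ᶠ y in 𝓝[≠] z, deriv u y ^ k = R (u y) := by
  refine and_congr_right fun hu => ⟨fun hode z hz => ?_, fun hode z hz hanalytic => ?_⟩
  · filter_upwards [(hu z hz).eventually_analyticAt, nhdsWithin_le_nhds (hU.mem_nhds hz)]
      with y hy hyU using hode y hyU hy
  · have hlhs : ContinuousAt (fun y => deriv u y ^ k) z := hanalytic.deriv.continuousAt.pow k
    have hrhs : ContinuousAt (fun y => R (u y)) z := hR.continuousAt.comp hanalytic.continuousAt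
    exact ((hlhs.eventuallyEq_nhds_iff_eventuallyEq_nhdsNE hrhs).1 (hode z hz)).eq_of_nhds

theorem IsMeromorphicSolutionOn.congr (hR : Continuous R) (hU : IsOpen U)
    (hv : IsMeromorphicSolutionOn k R U v) (h : SameMeromorphicOn U u v) :
    IsMeromorphicSolutionOn k R U u := by
  rw [isMeromorphicSolutionOn_iff_eventually_nhdsNE hR hU] at hv ⊢
  refine ⟨fun z hz => (hv.1 z hz).congr (h.eventuallyEq_nhdsNE hU hz).symm, fun z hz => ?_⟩
  have heq := h.eventuallyEq_nhdsNE hU hz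
  filter_upwards [hv.2 z hz, heq, heq.nhdsNE_deriv] with y hode hval hderiv
  rw [hderiv, hode, hval]

theorem IsMeromorphicSolutionOn.mono {V : Set ℂ} (hu : IsMeromorphicSolutionOn k R U u)
    (hVU : V ⊆ U) : IsMeromorphicSolutionOn k R V u :=
  ⟨fun z hz => hu.1 z (hVU hz), fun z hz => hu.2 z (hVU hz)⟩

theorem IsMeromorphicSolutionOn.comp_sub_const (hφ : IsMeromorphicSolutionOn k R Set.univ φ)
    (z₀ : ℂ) : IsMeromorphicSolutionOn k R Set.univ fun z => φ (z - z₀) := by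
  refine ⟨fun z _ => (hφ.1 (z - z₀) (Set.mem_univ _)).comp_analyticAt (g := fun z => z - z₀)
    (by fun_prop), fun z _ hanalytic => ?_⟩
  have hφz : AnalyticAt ℂ φ (z - z₀) := by
    have hcomp : AnalyticAt ℂ ((fun z => φ (z - z₀)) ∘ fun y => y + z₀) (z - z₀) :=
      AnalyticAt.comp (by simpa using hanalytic) (by fun_prop)
    simpa [Function.comp_def] using hcomp
  rw [deriv_comp_sub_const]
  exact hφ.2 _ (Set.mem_univ _) hφz

theorem IsMeromorphicSolutionOn.exists_analyticAt_apply_ne_zero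
    (hu : IsMeromorphicSolutionOn k R U u) (hUo : IsOpen U) (hUc : IsConnected U)
    (hconst : ¬ ∃ c : ℂ, SameMeromorphicOn U u fun _ => c) :
    ∃ z ∈ U, AnalyticAt ℂ u z ∧ R (u z) ≠ 0 := by
  by_contra! hzero
  obtain ⟨x, hx⟩ := hUc.nonempty
  obtain ⟨z, hz, hzU⟩ := ((hu.1 x hx).eventually_analyticAt.and
    (nhdsWithin_le_nhds (hUo.mem_nhds hx))).exists
  have hderiv : deriv u =ᶠ[𝓝 z] 0 := by
    filter_upwards [hz.eventually_analyticAt, hUo.mem_nhds hzU] with y hy hyU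
    exact eq_zero_of_pow_eq_zero ((hu.2 y hyU hy).trans (hzero y hyU hy))
  exact hconst ⟨u z, sameMeromorphicOn_of_eventuallyEq_nhdsNE hUc.isPreconnected hu.1
    (fun y _ => MeromorphicAt.const _ _) hzU
    (nhdsWithin_le_nhds (eventuallyEq_const_of_deriv_eventuallyEq_zero hz hderiv))⟩

/-- `φ` attains every regular initial datum of the equation `(u')^k = R(u)`: every point `(b, c)`
of the curve `c ^ k = R b` with `R b ≠ 0` is the pair (value, derivative) of `φ` at some point of
analyticity. -/
def AttainsRegularInitialData (k : ℕ) (R φ : ℂ → ℂ) : Prop :=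
  ∀ b c, R b ≠ 0 → c ^ k = R b → ∃ p, AnalyticAt ℂ φ p ∧ φ p = b ∧ deriv φ p = c

theorem AttainsRegularInitialData.exists_deriv_ne_zero (h : AttainsRegularInitialData k R φ)
    (hk : k ≠ 0) (hR : ∃ b, R b ≠ 0) : ∃ p, AnalyticAt ℂ φ p ∧ deriv φ p ≠ 0 := by
  obtain ⟨b, hb⟩ := hR
  obtain ⟨c, hc⟩ := IsAlgClosed.exists_pow_nat_eq (R b) (Nat.pos_of_ne_zero hk)
  obtain ⟨p, hp, -, hderiv⟩ := h b c hb hc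
  refine ⟨p, hp, fun hzero => hb ?_⟩
  rw [← hc, ← hderiv, hzero, zero_pow hk]

theorem AttainsRegularInitialData.exists_sameMeromorphicOn (h : AttainsRegularInitialData k R φ)
    (hk : k ≠ 0) (hφ : IsMeromorphicSolutionOn k R Set.univ φ)
    (hUo : IsOpen U) (hUc : IsConnected U) (hu : IsMeromorphicSolutionOn k R U u)
    (hconst : ¬ ∃ c : ℂ, SameMeromorphicOn U u fun _ => c) :
    ∃ z₀ : ℂ, SameMeromorphicOn U u fun z => φ (z - z₀) := by
  obtain ⟨z, hzU, hz, hregular⟩ := hu.exists_analyticAt_apply_ne_zero hUo hUc hconst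
  obtain ⟨p, hp, hval, hderiv⟩ := h (u z) (deriv u z) hregular (hu.2 z hzU hz)
  have hderiv_ne : deriv u z ≠ 0 := fun hzero =>
    hregular (by rw [← hu.2 z hzU hz, hzero, zero_pow hk])
  have huode : ∀ᶠ y in 𝓝 z, deriv u y ^ k = R (u y) := by
    filter_upwards [hz.eventually_analyticAt, hUo.mem_nhds hzU] with y hy hyU
      using hu.2 y hyU hy
  have hφode : ∀ᶠ y in 𝓝 p, deriv φ y ^ k = R (φ y) :=
    hp.eventually_analyticAt.mono fun y hy => hφ.2 y (Set.mem_univ y) hy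
  have hlocal : u =ᶠ[𝓝 z] fun y => φ (y - (z - p)) :=
    eventuallyEq_comp_sub_of_deriv_pow_eq hk hz hp hval hderiv hderiv_ne huode hφode
  exact ⟨z - p, sameMeromorphicOn_of_eventuallyEq_nhdsNE hUc.isPreconnected hu.1
    ((hφ.comp_sub_const _).mono (Set.subset_univ U)).1 hzU (nhdsWithin_le_nhds hlocal)⟩

theorem AttainsRegularInitialData.isGeneralSolution (h : AttainsRegularInitialData k R φ)
    (hk : k ≠ 0) (hR : Continuous R) (hRne : ∃ b, R b ≠ 0)
    (hφ : IsMeromorphicSolutionOn k R Set.univ φ) :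
    IsGeneralSolution k R fun z₀ z => φ (z - z₀) := by
  intro U hUo hUc u
  refine ⟨fun ⟨hu, hconst⟩ => h.exists_sameMeromorphicOn hk hφ hUo hUc hu hconst, ?_⟩
  rintro ⟨z₀, hsame⟩
  have htranslate := hφ.comp_sub_const z₀
  refine ⟨(htranslate.mono (Set.subset_univ U)).congr hR hUo hsame, fun ⟨c, hc⟩ => ?_⟩
  obtain ⟨p, hp, hderiv⟩ := h.exists_deriv_ne_zero hk hRne
  have hp' : AnalyticAt ℂ (fun z => φ (z - z₀)) (p + z₀) :=
    AnalyticAt.comp (g := φ) (by simpa using hp) (by fun_prop)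
  refine not_sameMeromorphicOn_const hUo hUc.nonempty
    (fun z => htranslate.1 z (Set.mem_univ z)) hp' ?_ c (hsame.symm.trans hc)
  rwa [deriv_comp_sub_const, add_sub_cancel_right]

end GeneralSolution

section Weierstrass

theorem eventually_ne_of_meromorphic {𝕜 E : Type*} [NontriviallyNormedField 𝕜]
    [PreconnectedSpace 𝕜] [NormedAddCommGroup E] [NormedSpace 𝕜 E] {F : 𝕜 → E} (hF : Meromorphic F)
    {c : E} {p : 𝕜} (hp : ContinuousAt F p) (hne : F p ≠ c) (z : 𝕜) :
    ∀ᶠ y in 𝓝[≠] z, F y ≠ c := by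
  have hsub : MeromorphicOn (fun y => F y - c) Set.univ :=
    fun y _ => (hF y).sub (MeromorphicAt.const c y)
  have hp_order : meromorphicOrderAt (fun y => F y - c) p ≠ ⊤ := by
    rw [meromorphicOrderAt_ne_top_iff_eventually_ne_zero (hsub p (Set.mem_univ p))]
    exact nhdsWithin_le_nhds ((hp.eventually_ne hne).mono fun y hy => sub_ne_zero.2 hy)
  have hz_order := hsub.meromorphicOrderAt_ne_top_of_isPreconnected isPreconnected_univ
    (Set.mem_univ p) (Set.mem_univ z) hp_order
  rw [meromorphicOrderAt_ne_top_iff_eventually_ne_zero (hsub z (Set.mem_univ z))] at hz_order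
  exact hz_order.mono fun y hy => sub_ne_zero.1 hy

theorem apply_eq_apply_of_differentiable_of_lattice_periodic {E F : Type*}
    [NormedAddCommGroup E] [NormedSpace ℂ E] [FiniteDimensional ℂ E] [NormedAddCommGroup F]
    [NormedSpace ℂ F] (Λ : Submodule ℤ E) [DiscreteTopology Λ] [IsZLattice ℝ Λ] {f : E → F}
    (hf : Differentiable ℂ f) (hperiodic : ∀ z, ∀ w ∈ Λ, f (z + w) = f z) (z w : E) :
    f z = f w :=
  have : FiniteDimensional ℝ E := FiniteDimensional.complexToReal E
  hf.apply_eq_apply_of_bounded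
    (IsZLattice.isCompact_range_of_periodic Λ f hf.continuous hperiodic).isBounded z w

variable (P : PeriodPair)

theorem compl_lattice_mem_nhds {z : ℂ} (hz : z ∉ P.lattice) : (P.lattice : Set ℂ)ᶜ ∈ 𝓝 z :=
  P.isClosed_lattice.isOpen_compl.mem_nhds hz

theorem compl_lattice_mem_nhdsNE (z : ℂ) : (P.lattice : Set ℂ)ᶜ ∈ 𝓝[≠] z := by
  filter_upwards [nhdsWithin_le_nhds (P.compl_lattice_sdiff_singleton_mem_nhds z),
    self_mem_nhdsWithin] with y hy hyz hmem
  exact hy ⟨hmem, hyz⟩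

theorem tendsto_inv_weierstrassP_sub (x : ℂ) {l : ℂ} (hl : l ∈ P.lattice) :
    Tendsto (fun z => (P.weierstrassP z - x)⁻¹) (𝓝[≠] l) (𝓝 0) := by
  have hpole : Tendsto P.weierstrassP (𝓝[≠] l) (Bornology.cobounded ℂ) :=
    tendsto_cobounded_of_meromorphicOrderAt_neg (by rw [P.order_weierstrassP l hl]; decide)
  simpa only [sub_eq_add_neg, Function.comp_def] using
    tendsto_inv₀_cobounded.comp ((tendsto_add_const_cobounded (-x)).comp hpole)

open Classical in
/-- The reciprocal of `℘ - x`, with its removable singularities at the poles of `℘` filled in by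
`0`. -/
noncomputable def invWeierstrassPSub (x z : ℂ) : ℂ :=
  if z ∈ P.lattice then 0 else (P.weierstrassP z - x)⁻¹

theorem invWeierstrassPSub_of_mem (x : ℂ) {z : ℂ} (hz : z ∈ P.lattice) :
    invWeierstrassPSub P x z = 0 :=
  if_pos hz

theorem invWeierstrassPSub_of_notMem (x : ℂ) {z : ℂ} (hz : z ∉ P.lattice) :
    invWeierstrassPSub P x z = (P.weierstrassP z - x)⁻¹ :=
  if_neg hz

theorem invWeierstrassPSub_add_of_mem (x z : ℂ) {w : ℂ} (hw : w ∈ P.lattice) :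
    invWeierstrassPSub P x (z + w) = invWeierstrassPSub P x z := by
  have hmem : z + w ∈ P.lattice ↔ z ∈ P.lattice := P.lattice.add_mem_iff_left hw
  have hval : P.weierstrassP (z + w) = P.weierstrassP z := P.weierstrassP_add_coe z ⟨w, hw⟩
  by_cases hz : z ∈ P.lattice
  · rw [invWeierstrassPSub_of_mem P x hz, invWeierstrassPSub_of_mem P x (hmem.2 hz)]
  · rw [invWeierstrassPSub_of_notMem P x hz, invWeierstrassPSub_of_notMem P x (mt hmem.1 hz), hval]

theorem differentiable_invWeierstrassPSub {x : ℂ}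
    (hx : ∀ z, z ∉ P.lattice → P.weierstrassP z ≠ x) :
    Differentiable ℂ (invWeierstrassPSub P x) := by
  have hoff : ∀ z, z ∉ P.lattice → DifferentiableAt ℂ (invWeierstrassPSub P x) z := by
    intro z hz
    refine (((P.analyticOnNhd_weierstrassP z hz).differentiableAt.sub_const x).inv
      (sub_ne_zero.2 (hx z hz))).congr_of_eventuallyEq ?_
    filter_upwards [compl_lattice_mem_nhds P hz] with y hy
    exact invWeierstrassPSub_of_notMem P x hy
  intro l
  by_cases hl : l ∈ P.lattice
  · refine (Complex.analyticAt_of_differentiable_on_punctured_nhds_of_continuousAt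
      (eventually_of_mem (compl_lattice_mem_nhdsNE P l) hoff) ?_).differentiableAt
    rw [continuousAt_iff_punctured_nhds, invWeierstrassPSub_of_mem P x hl]
    refine (tendsto_inv_weierstrassP_sub P x hl).congr' ?_
    filter_upwards [compl_lattice_mem_nhdsNE P l] with y hy
    exact (invWeierstrassPSub_of_notMem P x hy).symm
  · exact hoff l hl

theorem exists_weierstrassP_eq (x : ℂ) : ∃ z, z ∉ P.lattice ∧ P.weierstrassP z = x := by
  by_contra! homit
  have hω := P.ω₁_div_two_notMem_lattice
  have hconst : invWeierstrassPSub P x (P.ω₁ / 2) = invWeierstrassPSub P x 0 :=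
    apply_eq_apply_of_differentiable_of_lattice_periodic P.lattice
      (differentiable_invWeierstrassPSub P homit)
      (fun z _ hw => invWeierstrassPSub_add_of_mem P x z hw) _ _
  rw [invWeierstrassPSub_of_notMem P x hω, invWeierstrassPSub_of_mem P x (zero_mem _)] at hconst
  exact inv_ne_zero (sub_ne_zero.2 (homit _ hω)) hconst

theorem exists_weierstrassP_eq_derivWeierstrassP_eq {x y : ℂ}
    (h : y ^ 2 = 4 * x ^ 3 - P.g₂ * x - P.g₃) :
    ∃ z, z ∉ P.lattice ∧ P.weierstrassP z = x ∧ P.derivWeierstrassP z = y := by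
  obtain ⟨z, hz, hx⟩ := exists_weierstrassP_eq P x
  have hsq : P.derivWeierstrassP z ^ 2 = y ^ 2 := by rw [P.derivWeierstrassP_sq z hz, hx, h]
  rcases sq_eq_sq_iff_eq_or_eq_neg.1 hsq with hy | hy
  · exact ⟨z, hz, hx, hy⟩
  · exact ⟨-z, by simpa using hz, by simpa using hx, by simp [hy]⟩

theorem exists_derivWeierstrassP_eq (y : ℂ) :
    ∃ z, z ∉ P.lattice ∧ P.derivWeierstrassP z = y := by
  obtain ⟨x, hx⟩ := IsAlgClosed.exists_root (Cubic.toPoly ⟨4, 0, -P.g₂, -P.g₃ - y ^ 2⟩)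
    (by rw [Cubic.degree_of_a_ne_zero (by norm_num)]; decide)
  simp only [Cubic.toPoly, map_zero, zero_mul, add_zero, Polynomial.IsRoot.def,
    Polynomial.eval_add, Polynomial.eval_mul, Polynomial.eval_C, Polynomial.eval_pow,
    Polynomial.eval_X] at hx
  obtain ⟨z, hz, -, hy⟩ := exists_weierstrassP_eq_derivWeierstrassP_eq P (x := x) (y := y)
    (by linear_combination -hx)
  exact ⟨z, hz, hy⟩

theorem eventually_weierstrassP_ne (x z : ℂ) : ∀ᶠ y in 𝓝[≠] z, P.weierstrassP y ≠ x := by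
  obtain ⟨p, hp, hpx⟩ := exists_weierstrassP_eq P (x + 1)
  exact eventually_ne_of_meromorphic P.meromorphic_weierstrassP
    (P.analyticOnNhd_weierstrassP p hp).continuousAt (by simp [hpx]) z

theorem eventually_derivWeierstrassP_ne (x z : ℂ) :
    ∀ᶠ y in 𝓝[≠] z, P.derivWeierstrassP y ≠ x := by
  obtain ⟨p, hp, hpx⟩ := exists_derivWeierstrassP_eq P (x + 1)
  exact eventually_ne_of_meromorphic P.meromorphic_derivWeierstrassP
    (P.analyticOnNhd_derivWeierstrassP p hp).continuousAt (by simp [hpx]) z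

theorem hasDerivAt_weierstrassP {z : ℂ} (hz : z ∉ P.lattice) :
    HasDerivAt P.weierstrassP (P.derivWeierstrassP z) z := by
  rw [← P.deriv_weierstrassP]
  exact (P.analyticOnNhd_weierstrassP z hz).differentiableAt.hasDerivAt

theorem derivWeierstrassP_mul_deriv_derivWeierstrassP {z : ℂ} (hz : z ∉ P.lattice) :
    P.derivWeierstrassP z * deriv P.derivWeierstrassP z =
      P.derivWeierstrassP z * (6 * P.weierstrassP z ^ 2 - P.g₂ / 2) := by
  have hlhs := (P.analyticOnNhd_derivWeierstrassP z hz).differentiableAt.hasDerivAt.pow 2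
  have hP := hasDerivAt_weierstrassP P hz
  have hrhs := (((hP.pow 3).const_mul 4).sub (hP.const_mul P.g₂)).sub_const P.g₃
  have hcubic : (P.derivWeierstrassP ^ 2) =ᶠ[𝓝 z]
      fun y => 4 * P.weierstrassP y ^ 3 - P.g₂ * P.weierstrassP y - P.g₃ :=
    eventually_of_mem (compl_lattice_mem_nhds P hz) P.derivWeierstrassP_sq
  have hderiv := hlhs.unique (hrhs.congr_of_eventuallyEq hcubic)
  simp only [Nat.cast_ofNat, Nat.add_one_sub_one, pow_one] at hderiv
  linear_combination hderiv / 2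

theorem hasDerivAt_derivWeierstrassP {z : ℂ} (hz : z ∉ P.lattice) :
    HasDerivAt P.derivWeierstrassP (6 * P.weierstrassP z ^ 2 - P.g₂ / 2) z := by
  have hP' := P.analyticOnNhd_derivWeierstrassP z hz
  have hP : ContinuousAt P.weierstrassP z := (hasDerivAt_weierstrassP P hz).continuousAt
  have hpunctured : deriv P.derivWeierstrassP =ᶠ[𝓝[≠] z]
      fun y => 6 * P.weierstrassP y ^ 2 - P.g₂ / 2 := by
    filter_upwards [compl_lattice_mem_nhdsNE P z, eventually_derivWeierstrassP_ne P 0 z]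
      with y hy hy_ne
    exact mul_left_cancel₀ hy_ne (derivWeierstrassP_mul_deriv_derivWeierstrassP P hy)
  have hz_eq := ((hP'.deriv.continuousAt.eventuallyEq_nhds_iff_eventuallyEq_nhdsNE
    (by fun_prop)).1 hpunctured).eq_of_nhds
  exact hz_eq ▸ hP'.differentiableAt.hasDerivAt

theorem exists_double_root_of_discriminant_eq_zero {K : Type*} [Field K] [CharZero K] {a b : K}
    (h : a ^ 3 - 27 * b ^ 2 = 0) :
    ∃ e : K, ∀ x, 4 * x ^ 3 - a * x - b = 4 * (x - e) ^ 2 * (x + 2 * e) := by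
  by_cases ha : a = 0
  · have hb : b = 0 := by simpa [ha] using h
    exact ⟨0, fun x => by rw [ha, hb]; ring⟩
  · refine ⟨-(3 * b) / (2 * a), fun x => ?_⟩
    field_simp
    linear_combination -4 * (a * x + b) * h

theorem analyticOrderAt_derivWeierstrassP_ne_top (z : ℂ) :
    analyticOrderAt P.derivWeierstrassP z ≠ ⊤ := by
  intro htop
  obtain ⟨y, hy_ne, hy⟩ := ((eventually_derivWeierstrassP_ne P 0 z).and
    (nhdsWithin_le_nhds (analyticOrderAt_eq_top.1 htop))).exists
  exact hy_ne hy

/- If the cubic had a double root `e`, then `℘'^2 = 4 (℘ - e)^2 (℘ + 2e)`. At a point where `℘ = e`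
the right side vanishes to order at least `2 (n + 1)`, where `n` is the order of `℘'`, whereas the
left side vanishes to order `2 n`. -/
theorem discriminant_ne_zero : P.g₂ ^ 3 - 27 * P.g₃ ^ 2 ≠ 0 := by
  intro hdisc
  obtain ⟨e, he⟩ := exists_double_root_of_discriminant_eq_zero hdisc
  obtain ⟨z, hz, hze⟩ := exists_weierstrassP_eq P e
  have hP := P.analyticOnNhd_weierstrassP z hz
  have hsub : AnalyticAt ℂ (fun y => P.weierstrassP y - e) z := by fun_prop
  have hadd : AnalyticAt ℂ (fun y => 4 * (P.weierstrassP y + 2 * e)) z := by fun_prop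
  have hcubic : P.derivWeierstrassP ^ 2 =ᶠ[𝓝 z]
      (fun y => P.weierstrassP y - e) ^ 2 * fun y => 4 * (P.weierstrassP y + 2 * e) := by
    filter_upwards [compl_lattice_mem_nhds P hz] with y hy
    simp only [Pi.pow_apply, Pi.mul_apply, P.derivWeierstrassP_sq y hy, he]
    ring
  have horder : analyticOrderAt (fun y => P.weierstrassP y - e) z =
      analyticOrderAt P.derivWeierstrassP z + 1 := by
    rw [← hze, ← hP.analyticOrderAt_deriv_add_one, P.deriv_weierstrassP]
  have hcompare := analyticOrderAt_congr hcubic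
  rw [analyticOrderAt_pow (P.analyticOnNhd_derivWeierstrassP z hz),
    analyticOrderAt_mul (hsub.pow 2) hadd, analyticOrderAt_pow hsub, horder] at hcompare
  obtain ⟨n, hn⟩ := ENat.ne_top_iff_exists.1 (analyticOrderAt_derivWeierstrassP_ne_top P z)
  rw [← hn] at hcompare
  have hle : 2 • ((n : ℕ∞) + 1) ≤ 2 • (n : ℕ∞) := hcompare ▸ le_self_add
  simp only [two_nsmul] at hle
  norm_cast at hle
  omega

end Weierstrass

section PeriodLattices

theorem G_eq_of_lattice_scaling {P Q : PeriodPair} (c : ℂˣ)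
    (h : ∀ z : ℂ, c * z ∈ Q.lattice ↔ z ∈ P.lattice) (n : ℕ) : Q.G n = P.G n / c ^ n := by
  let e : P.lattice ≃ Q.lattice := c.mulLeft.subtypeEquiv fun z => (h z).symm
  rw [PeriodPair.G, PeriodPair.G, ← e.tsum_eq, ← tsum_div_const]
  refine tsum_congr fun z => ?_
  rw [show (e z : ℂ) = c * z from rfl, mul_pow, mul_inv, inv_mul_eq_div]

theorem G_eq_zero_of_lattice_symmetry {P : PeriodPair} (c : ℂˣ)
    (h : ∀ z : ℂ, c * z ∈ P.lattice ↔ z ∈ P.lattice) {n : ℕ} (hn : c ^ n ≠ 1) : P.G n = 0 := by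
  have hG : P.G n * (c ^ n : ℂ) = P.G n :=
    (eq_div_iff (pow_ne_zero n c.ne_zero)).1 (G_eq_of_lattice_scaling c h n)
  by_contra hG_ne
  exact hn (Units.ext (by simpa using mul_left_cancel₀ hG_ne (hG.trans (mul_one _).symm)))

/-- The period pair `(c ω₁, c ω₂)`, whose lattice is that of `P` multiplied by `c`. -/
def scalePeriods (P : PeriodPair) (c : ℂˣ) : PeriodPair where
  ω₁ := c * P.ω₁
  ω₂ := c * P.ω₂
  indep := by
    have hindep := P.indep
    rw [LinearIndependent.pair_iff] at hindep ⊢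
    intro s t hst
    refine hindep s t (mul_left_cancel₀ c.ne_zero ?_)
    simp only [Complex.real_smul] at hst ⊢
    linear_combination hst

theorem mul_mem_lattice_scalePeriods (P : PeriodPair) (c : ℂˣ) (z : ℂ) :
    c * z ∈ (scalePeriods P c).lattice ↔ z ∈ P.lattice := by
  simp only [PeriodPair.mem_lattice, scalePeriods]
  refine exists₂_congr fun m n => ?_
  rw [← mul_right_inj' c.ne_zero (b := (m : ℂ) * P.ω₁ + n * P.ω₂), mul_add, mul_left_comm,
    mul_left_comm _ (n : ℂ)]

theorem G_scalePeriods (P : PeriodPair) (c : ℂˣ) (n : ℕ) :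
    (scalePeriods P c).G n = P.G n / c ^ n :=
  G_eq_of_lattice_scaling c (mul_mem_lattice_scalePeriods P c) n

theorem g₂_scalePeriods (P : PeriodPair) (c : ℂˣ) : (scalePeriods P c).g₂ = P.g₂ / c ^ 4 := by
  rw [PeriodPair.g₂, PeriodPair.g₂, G_scalePeriods, mul_div_assoc]

theorem g₃_scalePeriods (P : PeriodPair) (c : ℂˣ) : (scalePeriods P c).g₃ = P.g₃ / c ^ 6 := by
  rw [PeriodPair.g₃, PeriodPair.g₃, G_scalePeriods, mul_div_assoc]

theorem exists_unit_div_pow_eq {K : Type*} [Field K] [IsAlgClosed K] {a b : K} (ha : a ≠ 0)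
    (hb : b ≠ 0) {n : ℕ} (hn : n ≠ 0) : ∃ c : Kˣ, a / c ^ n = b := by
  obtain ⟨c, hc⟩ := IsAlgClosed.exists_pow_nat_eq (a / b) (Nat.pos_of_ne_zero hn)
  have hc_ne : c ≠ 0 := (pow_ne_zero_iff hn).1 (hc ▸ div_ne_zero ha hb)
  exact ⟨Units.mk0 c hc_ne, by rw [Units.val_mk0, hc, div_div_cancel₀ ha]⟩

/-- The period pair `(1, τ)` of a nonreal number `τ`. -/
def periodPairOneOf (τ : ℂ) (hτ : τ.im ≠ 0) : PeriodPair where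
  ω₁ := 1
  ω₂ := τ
  indep := by
    rw [LinearIndependent.pair_iff]
    intro s t hst
    have ht : t = 0 := by simpa [hτ] using congrArg Complex.im hst
    exact ⟨by simpa [ht] using congrArg Complex.re hst, ht⟩

theorem mul_mem_lattice_periodPairOneOf {τ : ℂ} (hτ : τ.im ≠ 0) {a : ℤ} (h : τ ^ 2 = a * τ - 1)
    (z : ℂ) : τ * z ∈ (periodPairOneOf τ hτ).lattice ↔ z ∈ (periodPairOneOf τ hτ).lattice := by
  have hτ_ne : τ ≠ 0 := fun hzero => hτ (by simp [hzero])
  simp only [PeriodPair.mem_lattice, periodPairOneOf]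
  constructor
  · rintro ⟨m, n, hmn⟩
    refine ⟨m * a + n, -m, mul_left_cancel₀ hτ_ne ?_⟩
    push_cast
    linear_combination hmn - m * h
  · rintro ⟨m, n, hmn⟩
    refine ⟨-n, m + n * a, ?_⟩
    push_cast
    linear_combination τ * hmn - n * h

theorem exists_g₂_eq_zero : ∃ P : PeriodPair, P.g₂ = 0 := by
  obtain ⟨τ, hτ, hquad⟩ : ∃ τ : ℂ, τ.im ≠ 0 ∧ τ ^ 2 = (-1 : ℤ) * τ - 1 := by
    refine ⟨⟨-1 / 2, √3 / 2⟩, by simp, Complex.ext ?_ ?_⟩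
    · have hsqrt : √3 * √3 = 3 := Real.mul_self_sqrt (by norm_num)
      simp [sq]
      linarith
    · simp [sq]
      ring
  have hτ_ne : τ ≠ 0 := fun hzero => hτ (by simp [hzero])
  have hfour : τ ^ 4 = τ := by
    push_cast at hquad
    linear_combination (τ ^ 2 - τ) * hquad
  refine ⟨periodPairOneOf τ hτ, ?_⟩
  rw [PeriodPair.g₂, G_eq_zero_of_lattice_symmetry (Units.mk0 τ hτ_ne)
    (mul_mem_lattice_periodPairOneOf hτ hquad), mul_zero]
  intro hone
  have hτ_one : τ = 1 := by simpa [hfour] using congrArg Units.val hone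
  exact hτ (by simp [hτ_one])

theorem exists_g₃_eq_zero : ∃ P : PeriodPair, P.g₃ = 0 := by
  have hI : Complex.I.im ≠ 0 := by simp
  refine ⟨periodPairOneOf Complex.I hI, ?_⟩
  rw [PeriodPair.g₃, G_eq_zero_of_lattice_symmetry (Units.mk0 Complex.I Complex.I_ne_zero)
    (mul_mem_lattice_periodPairOneOf hI (a := 0) (by simp)), mul_zero]
  intro hone
  have hI_six : Complex.I ^ 6 = 1 := by simpa using congrArg Units.val hone
  rw [Complex.I_pow_eq_pow_mod] at hI_six
  norm_num at hI_six

theorem exists_g₂_eq_zero_g₃_eq {c : ℂ} (hc : c ≠ 0) :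
    ∃ P : PeriodPair, P.g₂ = 0 ∧ P.g₃ = c := by
  obtain ⟨P, hg₂⟩ := exists_g₂_eq_zero
  have hg₃ : P.g₃ ≠ 0 := fun hg₃ => discriminant_ne_zero P (by simp [hg₂, hg₃])
  obtain ⟨s, hs⟩ := exists_unit_div_pow_eq hg₃ hc (n := 6) (by norm_num)
  exact ⟨scalePeriods P s, by rw [g₂_scalePeriods, hg₂, zero_div], by rw [g₃_scalePeriods, hs]⟩

theorem exists_g₂_eq_g₃_eq_zero {c : ℂ} (hc : c ≠ 0) :
    ∃ P : PeriodPair, P.g₂ = c ∧ P.g₃ = 0 := by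
  obtain ⟨P, hg₃⟩ := exists_g₃_eq_zero
  have hg₂ : P.g₂ ≠ 0 := fun hg₂ => discriminant_ne_zero P (by simp [hg₂, hg₃])
  obtain ⟨s, hs⟩ := exists_unit_div_pow_eq hg₂ hc (n := 4) (by norm_num)
  exact ⟨scalePeriods P s, by rw [g₂_scalePeriods, hs], by rw [g₃_scalePeriods, hg₃, zero_div]⟩

end PeriodLattices

section SolutionsFromWeierstrass

variable {P : PeriodPair} {m a : ℂ}

theorem deriv_neg_div_derivWeierstrassP (m : ℂ) (hg₂ : P.g₂ = 0) {z : ℂ} (hz : z ∉ P.lattice)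
    (hne : P.derivWeierstrassP z ≠ 0) :
    deriv (fun z => -m / P.derivWeierstrassP z) z =
      6 * m * P.weierstrassP z ^ 2 / P.derivWeierstrassP z ^ 2 := by
  refine ((hasDerivAt_const z (-m)).div (hasDerivAt_derivWeierstrassP P hz) hne).deriv.trans ?_
  rw [hg₂]
  ring

theorem isMeromorphicSolutionOn_neg_div_derivWeierstrassP (hg₂ : P.g₂ = 0) (hg₃ : P.g₃ = -m ^ 2) :
    IsMeromorphicSolutionOn 3 (fun u => 27 * m / 2 * (u ^ 2 * (u - 1) ^ 2 * (u + 1) ^ 2))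
      Set.univ fun z => -m / P.derivWeierstrassP z := by
  refine (isMeromorphicSolutionOn_iff_eventually_nhdsNE (by fun_prop) isOpen_univ).2
    ⟨fun z _ => (MeromorphicAt.const (-m) z).div (P.meromorphic_derivWeierstrassP z),
      fun z _ => ?_⟩
  filter_upwards [compl_lattice_mem_nhdsNE P z, eventually_derivWeierstrassP_ne P 0 z]
    with y hy hne
  have hcubic : 4 * P.weierstrassP y ^ 3 = P.derivWeierstrassP y ^ 2 - m ^ 2 := by
    rw [P.derivWeierstrassP_sq y hy, hg₂, hg₃]
    ring
  rw [deriv_neg_div_derivWeierstrassP m hg₂ hy hne]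
  calc (6 * m * P.weierstrassP y ^ 2 / P.derivWeierstrassP y ^ 2) ^ 3
      = 27 * m ^ 3 / 2 * (4 * P.weierstrassP y ^ 3) ^ 2 / P.derivWeierstrassP y ^ 6 := by ring
    _ = 27 * m ^ 3 / 2 * (P.derivWeierstrassP y ^ 2 - m ^ 2) ^ 2 / P.derivWeierstrassP y ^ 6 := by
        rw [hcubic]
    _ = _ := by
        field_simp
        ring

theorem exists_cubic_point_of_pow_three_eq {K : Type*} [Field K] [CharZero K] {m b d : K}
    (hd : d ^ 3 = 27 * m / 2 * (b ^ 2 * (b - 1) ^ 2 * (b + 1) ^ 2)) (hd₀ : d ≠ 0) :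
    ∃ x y : K, y ^ 2 = 4 * x ^ 3 + m ^ 2 ∧ y ≠ 0 ∧ -m / y = b ∧ 6 * m * x ^ 2 / y ^ 2 = d := by
  have hm : m ≠ 0 := by
    rintro rfl
    exact pow_ne_zero 3 hd₀ (by rw [hd]; ring)
  have hb : b ≠ 0 := by
    rintro rfl
    exact pow_ne_zero 3 hd₀ (by rw [hd]; ring)
  set x := 3 * m * (1 - b ^ 2) / (2 * d) with hx
  have hx_sq : x ^ 2 = d * m / (6 * b ^ 2) := by
    rw [hx]
    field_simp
    linear_combination -4 * hd
  have hcubic : (-m / b) ^ 2 = 4 * x ^ 3 + m ^ 2 := by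
    rw [pow_succ x, hx_sq, hx]
    field_simp
    ring
  refine ⟨x, -m / b, hcubic, div_ne_zero (neg_ne_zero.2 hm) hb,
    div_div_cancel₀ (neg_ne_zero.2 hm), ?_⟩
  rw [hx_sq]
  field_simp

theorem attainsRegularInitialData_neg_div_derivWeierstrassP (hg₂ : P.g₂ = 0)
    (hg₃ : P.g₃ = -m ^ 2) :
    AttainsRegularInitialData 3 (fun u => 27 * m / 2 * (u ^ 2 * (u - 1) ^ 2 * (u + 1) ^ 2))
      fun z => -m / P.derivWeierstrassP z := by
  intro b d hb hd
  have hd₀ : d ≠ 0 := (pow_ne_zero_iff three_ne_zero).1 (hd ▸ hb)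
  obtain ⟨x, y, hcubic, hy, hval, hderiv⟩ := exists_cubic_point_of_pow_three_eq hd hd₀
  obtain ⟨p, hp, rfl, rfl⟩ := exists_weierstrassP_eq_derivWeierstrassP_eq P (x := x) (y := y)
    (by rw [hcubic, hg₂, hg₃]; ring)
  exact ⟨p, analyticAt_const.div (P.analyticOnNhd_derivWeierstrassP p hp) hy, hval,
    (deriv_neg_div_derivWeierstrassP m hg₂ hp hy).trans hderiv⟩

theorem isGeneralSolution_neg_div_derivWeierstrassP (hm : m ≠ 0) (hg₂ : P.g₂ = 0)
    (hg₃ : P.g₃ = -m ^ 2) :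
    IsGeneralSolution 3 (fun u => 27 * m / 2 * (u ^ 2 * (u - 1) ^ 2 * (u + 1) ^ 2))
      fun z₀ z => -m / P.derivWeierstrassP (z - z₀) :=
  (attainsRegularInitialData_neg_div_derivWeierstrassP hg₂ hg₃).isGeneralSolution
    three_ne_zero (by fun_prop) ⟨2, by norm_num [hm]⟩
    (isMeromorphicSolutionOn_neg_div_derivWeierstrassP hg₂ hg₃)

theorem deriv_one_add_div_weierstrassP_sq_sub (a : ℂ) {z : ℂ} (hz : z ∉ P.lattice)
    (hne : P.weierstrassP z ^ 2 - a ≠ 0) :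
    deriv (fun z => 1 + 2 * a / (P.weierstrassP z ^ 2 - a)) z =
      -(4 * a * P.weierstrassP z * P.derivWeierstrassP z) / (P.weierstrassP z ^ 2 - a) ^ 2 := by
  have hden := ((hasDerivAt_weierstrassP P hz).pow 2).sub_const a
  refine (((hasDerivAt_const z (2 * a)).div hden hne).const_add 1).deriv.trans ?_
  simp only [Pi.pow_apply, Nat.cast_ofNat, Nat.add_one_sub_one, pow_one]
  ring

theorem eventually_weierstrassP_sq_sub_ne_zero (P : PeriodPair) (a z : ℂ) :
    ∀ᶠ y in 𝓝[≠] z, P.weierstrassP y ^ 2 - a ≠ 0 := by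
  obtain ⟨r, rfl⟩ := IsAlgClosed.exists_pow_nat_eq a two_pos
  filter_upwards [eventually_weierstrassP_ne P r z, eventually_weierstrassP_ne P (-r) z]
    with y hpos hneg
  rw [sub_ne_zero, Ne, sq_eq_sq_iff_eq_or_eq_neg, not_or]
  exact ⟨hpos, hneg⟩

theorem isMeromorphicSolutionOn_one_add_div_weierstrassP_sq_sub (hg₂ : P.g₂ = -4 * a)
    (hg₃ : P.g₃ = 0) :
    IsMeromorphicSolutionOn 4 (fun u => 64 * a * (u ^ 2 * (u - 1) ^ 3 * (u + 1) ^ 3))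
      Set.univ fun z => 1 + 2 * a / (P.weierstrassP z ^ 2 - a) := by
  refine (isMeromorphicSolutionOn_iff_eventually_nhdsNE (by fun_prop) isOpen_univ).2
    ⟨fun z _ => ?_, fun z _ => ?_⟩
  · have := P.meromorphic_weierstrassP z
    fun_prop
  filter_upwards [compl_lattice_mem_nhdsNE P z, eventually_weierstrassP_sq_sub_ne_zero P a z]
    with y hy hne
  have hcubic : P.derivWeierstrassP y ^ 2 =
      4 * P.weierstrassP y * (P.weierstrassP y ^ 2 + a) := by
    rw [P.derivWeierstrassP_sq y hy, hg₂, hg₃]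
    ring
  rw [deriv_one_add_div_weierstrassP_sq_sub a hy hne]
  calc (-(4 * a * P.weierstrassP y * P.derivWeierstrassP y) / (P.weierstrassP y ^ 2 - a) ^ 2) ^ 4
      = 256 * a ^ 4 * P.weierstrassP y ^ 4 * (P.derivWeierstrassP y ^ 2) ^ 2 /
          ((P.weierstrassP y ^ 2 - a) ^ 2) ^ 4 := by
        rw [div_pow]
        ring
    _ = 256 * a ^ 4 * P.weierstrassP y ^ 4 *
          (4 * P.weierstrassP y * (P.weierstrassP y ^ 2 + a)) ^ 2 /
          ((P.weierstrassP y ^ 2 - a) ^ 2) ^ 4 := by rw [hcubic]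
    _ = _ := by
        field_simp
        ring

theorem exists_cubic_point_of_pow_four_eq {K : Type*} [Field K] [CharZero K] {a b d : K}
    (hd : d ^ 4 = 64 * a * (b ^ 2 * (b - 1) ^ 3 * (b + 1) ^ 3)) (hd₀ : d ≠ 0) :
    ∃ x y : K, y ^ 2 = 4 * x ^ 3 + 4 * a * x ∧ x ^ 2 - a ≠ 0 ∧ 1 + 2 * a / (x ^ 2 - a) = b ∧
      -(4 * a * x * y) / (x ^ 2 - a) ^ 2 = d := by
  have hR : 64 * a * (b ^ 2 * (b - 1) ^ 3 * (b + 1) ^ 3) ≠ 0 := hd ▸ pow_ne_zero 4 hd₀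
  obtain ⟨ha, ⟨hb, hb_sub⟩, hb_add⟩ : a ≠ 0 ∧ (b ≠ 0 ∧ b - 1 ≠ 0) ∧ b + 1 ≠ 0 := by
    simpa [not_or] using hR
  set x := d ^ 2 / (8 * b * (b + 1) * (b - 1) ^ 2) with hx
  have hx₀ : x ≠ 0 := div_ne_zero (pow_ne_zero 2 hd₀) (by simp [hb, hb_sub, hb_add])
  have hd_sq : d ^ 2 = 8 * b * (b + 1) * (b - 1) ^ 2 * x := by
    rw [hx]
    field_simp
  have hx_sq : x ^ 2 = a * (b + 1) / (b - 1) := by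
    rw [hx]
    field_simp
    linear_combination hd
  have hx_sub : x ^ 2 - a = 2 * a / (b - 1) := by
    rw [hx_sq]
    field_simp
    ring
  have h2a : 2 * a ≠ 0 := mul_ne_zero two_ne_zero ha
  refine ⟨x, -(d * a) / ((b - 1) ^ 2 * x), ?_, hx_sub ▸ div_ne_zero h2a hb_sub, ?_, ?_⟩
  · calc (-(d * a) / ((b - 1) ^ 2 * x)) ^ 2
        = d ^ 2 * a ^ 2 / ((b - 1) ^ 4 * x ^ 2) := by
          rw [div_pow]
          ring
      _ = 4 * x * (x ^ 2 + a) := by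
          rw [hd_sq, hx_sq]
          field_simp
          ring
      _ = 4 * x ^ 3 + 4 * a * x := by ring
  · rw [hx_sub, div_div_cancel₀ h2a, add_sub_cancel]
  · rw [hx_sub]
    field_simp
    ring

theorem attainsRegularInitialData_one_add_div_weierstrassP_sq_sub (hg₂ : P.g₂ = -4 * a)
    (hg₃ : P.g₃ = 0) :
    AttainsRegularInitialData 4 (fun u => 64 * a * (u ^ 2 * (u - 1) ^ 3 * (u + 1) ^ 3))
      fun z => 1 + 2 * a / (P.weierstrassP z ^ 2 - a) := by
  intro b d hb hd
  have hd₀ : d ≠ 0 := (pow_ne_zero_iff four_ne_zero).1 (hd ▸ hb)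
  obtain ⟨x, y, hcubic, hx, hval, hderiv⟩ := exists_cubic_point_of_pow_four_eq hd hd₀
  obtain ⟨p, hp, rfl, rfl⟩ := exists_weierstrassP_eq_derivWeierstrassP_eq P (x := x) (y := y)
    (by rw [hcubic, hg₂, hg₃]; ring)
  exact ⟨p, analyticAt_const.add (analyticAt_const.div
      (((P.analyticOnNhd_weierstrassP p hp).pow 2).sub analyticAt_const) hx), hval,
    (deriv_one_add_div_weierstrassP_sq_sub a hp hx).trans hderiv⟩

theorem isGeneralSolution_one_add_div_weierstrassP_sq_sub (ha : a ≠ 0) (hg₂ : P.g₂ = -4 * a)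
    (hg₃ : P.g₃ = 0) :
    IsGeneralSolution 4 (fun u => 64 * a * (u ^ 2 * (u - 1) ^ 3 * (u + 1) ^ 3))
      fun z₀ z => 1 + 2 * a / (P.weierstrassP (z - z₀) ^ 2 - a) :=
  (attainsRegularInitialData_one_add_div_weierstrassP_sq_sub hg₂ hg₃).isGeneralSolution
    four_ne_zero (by fun_prop) ⟨2, by norm_num [ha]⟩
    (isMeromorphicSolutionOn_one_add_div_weierstrassP_sq_sub hg₂ hg₃)

end SolutionsFromWeierstrass

theorem mainTheorem2 (L : ℂ) (hL : L ≠ 0) :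
    ((∃ P : PeriodPair, P.g₂ = 0 ∧ P.g₃ = -(4 * L ^ 6) / 729) ∧
      ∀ P : PeriodPair, P.g₂ = 0 → P.g₃ = -(4 * L ^ 6) / 729 →
        IsGeneralSolution 3 (fun u => L ^ 3 * u ^ 2 * (u - 1) ^ 2 * (u + 1) ^ 2)
          (fun z₀ z => -(2 * L ^ 3) / (27 * P.derivWeierstrassP (z - z₀)))) ∧
    ((∃ P : PeriodPair, P.g₂ = -L ^ 4 / 16 ∧ P.g₃ = 0) ∧
      ∀ P : PeriodPair, P.g₂ = -L ^ 4 / 16 → P.g₃ = 0 →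
        IsGeneralSolution 4 (fun u => L ^ 4 * u ^ 2 * (u - 1) ^ 3 * (u + 1) ^ 3)
          (fun z₀ z => 1 + L ^ 4 / (32 * (P.weierstrassP (z - z₀) ^ 2 - L ^ 4 / 64)))) := by
  refine ⟨⟨exists_g₂_eq_zero_g₃_eq (by simp [hL]), fun P hg₂ hg₃ => ?_⟩,
    ⟨exists_g₂_eq_g₃_eq_zero (by simp [hL]), fun P hg₂ hg₃ => ?_⟩⟩
  · convert isGeneralSolution_neg_div_derivWeierstrassP (m := 2 * L ^ 3 / 27) (by simp [hL]) hg₂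
      (by rw [hg₃]; ring) using 2
    · ring
    · funext z
      ring
  · convert isGeneralSolution_one_add_div_weierstrassP_sq_sub (a := L ^ 4 / 64) (by simp [hL])
      (by rw [hg₂]; ring) hg₃ using 2
    · ring
    · funext z
      rw [← div_div]
      ring
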